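/- Let $n\ge 1$, $T_{per}>0$, and let $\lambda_0,\dots,\lambda_n:\mathbb R\to[0,\infty)$ satisfy $\lambda_k(t+T_{per})=\lambda_k(t)$ for all $t$ and $k$. Assume that each $\lambda_k|_{[0,T_{per}]}$ is an $L^1$ function that is not zero as an element of $L^1$ (i.e. not a.e. zero). **Nonautonomous TASEP.** On a probability space $(\Omega,\mathcal F,\mathbb P)$ let $\Pi_0,\dots,\Pi_n$ be independent non-homogeneous Poisson processes on $\mathbb R$ with rates $\lambda_0,\dots,\lambda_n$; that is, with $M_k(t)=\int_0^t\lambda_k(s)\,ds$, the point set $M_k(\Pi_k)$ is a homogeneous Poisson process of rate $1$ on $\mathbb R$. The usual null events are removed from $\Omega$: for every $\omega$ the points of $\Pi_k(\omega)$ do not accumulate, no point $s$ of $\Pi_k(\omega)$ has $M_k(u)=M_k(s)$ for some $u\neq s$, and the sets $\Pi_k(\omega)$ are pairwise disjoint. The state space is $X=\{0,1\}^n$ with the discrete metric. A jump attempt of clock $k$ changes $x=(s_1,\dots,s_n)$ to $f(x,k)$, where $f(x,0)=(1,s_2,\dots,s_n)$, $f(x,n)=(s_1,\dots,s_{n-1},0)$,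 and for $0<k<n$ the map moves a particle from site $k$ to site $k+1$ if $s_k=1$ and $s_{k+1}=0$, and leaves $x$ unchanged otherwise. For $t\ge t_0$, $\varphi(t,t_0,x,\omega)$ is the state obtained from $x$ by carrying out, in chronological order, all jump attempts with times in $[t_0,t)$. Put $$A(t,\omega)=\bigcap_{t_0\le t}\varphi(t,t_0,X,\omega),\qquad \Gamma(t,t_0)=\{\omega:\ \varphi(t,t_0,x_1,\omega)=\varphi(t,t_0,x_2,\omega)\ \text{for all } x_1,x_2\in X\}.$$ Then, with $m=\frac{n(n+1)}2$ and $\Delta t=\frac{n(n+1)}2\,T_{per}$: 0. There are $R>r>0$ such that for every $\tau\in\mathbb R$ the interval $[\tau,\tau+\Delta t)$ can be divided by points $\tau=q_0<q_1<\dots<q_m=\tau+\Delta t$ with $r\le\int_{q_i}^{q_{i+1}}\lambda_k(t)\,dt\le R$ for all $0\le i<m$ and $0\le k\le n$. Moreover, $\varphi$ is a nonautonomous random dynamical system: it is jointly measurable in $(t,t_0,x,\omega)$, continuous in $x$, $\varphi(t,t,\cdot,\omega)$ is the identity, and $\varphi(t,t_0,x,\omega)=\varphi(t,s,\varphi(s,t_0,x,\omega),\omega)$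 for all $t\ge s\ge t_0$, $x$ and $\omega$. (a) $A$ is a global random pullback attractor: it is a compact nonautonomous random set (each $\{(x,\omega): x\in A(t,\omega)\}$ is measurable and each $A(t,\omega)$ is compact), almost surely $\varphi(t,t_0,A(t_0,\omega),\omega)=A(t,\omega)$ for all $t\ge t_0$, and for each $t$, almost surely $\lim_{t_0\to-\infty}\operatorname{dist}(\varphi(t,t_0,X,\omega),A(t,\omega))=0$, where $\operatorname{dist}(B,B')=\sup_{b\in B}\inf_{b'\in B'}d(b,b')$. For almost all $\omega$, $A(t,\omega)$ is a singleton for all $t\in\mathbb R$. (b) $A$ is also a global random forward attractor: for each $t_0$, almost surely $\lim_{t\to\infty}\operatorname{dist}(\varphi(t,t_0,X,\omega),A(t,\omega))=0$. The convergence $\mathbb P(\Gamma(t,t_0))\to1$ as $t_0\to-\infty$ has an exponential rate: there are $C,\gamma>0$ with $$1-\mathbb P(\Gamma(t,t_0))\le C\,e^{-\gamma(t-t_0)}\qquad\text{for all } t_0\le t .$$ -/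

import Mathlib

open MeasureTheory ProbabilityTheory Filter Topology Set

noncomputable section

namespace TASEP

/-! ### Nonautonomous random dynamical systems and their attractors -/

section NRDS

variable {X Ω : Type*} [MetricSpace X] [MeasurableSpace X] [BorelSpace X] [MeasurableSpace Ω]

/-- `φ t t₀ x ω` (read for `t₀ ≤ t`) is a nonautonomous random dynamical system with state
space `X`. -/
structure IsNRDS (φ : ℝ → ℝ → X → Ω → X) : Prop where
  measurable : Measurable (fun p : {q : ℝ × ℝ // q.2 ≤ q.1} × X × Ω =>
    φ p.1.1.1 p.1.1.2 p.2.1 p.2.2)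
  identity : ∀ t x ω, φ t t x ω = x
  cocycle : ∀ t s t₀, t₀ ≤ s → s ≤ t → ∀ x ω, φ t t₀ x ω = φ t s (φ s t₀ x ω) ω
  continuous : ∀ t s, s ≤ t → ∀ ω, Continuous (fun x => φ t s x ω)

/-- The image `φ(t, t₀, B, ω)` of a set `B` of initial states. -/
def imageSet (φ : ℝ → ℝ → X → Ω → X) (t t₀ : ℝ) (B : Set X) (ω : Ω) : Set X :=
  (fun x => φ t t₀ x ω) '' B

/-- The Hausdorff semi-distance `sup_{a ∈ A} inf_{b ∈ B} d(a, b)`, with values in `[0, ∞]`. -/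
def semiDist (A B : Set X) : ENNReal := ⨆ a ∈ A, ⨅ b ∈ B, edist a b

/-- The `ω`-section at time `t` of a family `C` of subsets of `X × Ω`. -/
def fiber (C : ℝ → Set (X × Ω)) (t : ℝ) (ω : Ω) : Set X := {x | (x, ω) ∈ C t}

/-- Compact nonautonomous random sets. -/
structure IsCompactRandomSet (C : ℝ → Set (X × Ω)) : Prop where
  measurable : ∀ t, MeasurableSet (C t)
  compact : ∀ t ω, IsCompact (fiber C t ω)

/-- Strict `φ`-invariance, almost surely. -/
def IsStrictlyInvariant (P : Measure Ω) (φ : ℝ → ℝ → X → Ω → X) (C : ℝ → Set (X × Ω)) : Prop :=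
  ∀ᵐ ω ∂P, ∀ t t₀, t₀ ≤ t → imageSet φ t t₀ (fiber C t₀ ω) ω = fiber C t ω

structure IsGlobalPullbackAttractor (P : Measure Ω) (φ : ℝ → ℝ → X → Ω → X)
    (C : ℝ → Set (X × Ω)) : Prop where
  randomSet : IsCompactRandomSet C
  invariant : IsStrictlyInvariant P φ C
  attracts : ∀ t, ∀ᵐ ω ∂P,
    Tendsto (fun t₀ => semiDist (imageSet φ t t₀ univ ω) (fiber C t ω)) atBot (𝓝 0)

structure IsGlobalForwardAttractor (P : Measure Ω) (φ : ℝ → ℝ → X → Ω → X)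
    (C : ℝ → Set (X × Ω)) : Prop where
  randomSet : IsCompactRandomSet C
  invariant : IsStrictlyInvariant P φ C
  attracts : ∀ t₀, ∀ᵐ ω ∂P,
    Tendsto (fun t => semiDist (imageSet φ t t₀ univ ω) (fiber C t ω)) atTop (𝓝 0)

/-- The random set with sections `A(t, ω) = ⋂_{t₀ ≤ t} φ(t, t₀, X, ω)`. -/
def limitSet (φ : ℝ → ℝ → X → Ω → X) (t : ℝ) : Set (X × Ω) :=
  {p | ∀ t₀, t₀ ≤ t → p.1 ∈ imageSet φ t t₀ univ p.2}

/-- The event `Γ(t, t₀)` that all solutions started at time `t₀` agree at time `t`. -/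
def syncEvent (φ : ℝ → ℝ → X → Ω → X) (t t₀ : ℝ) : Set Ω :=
  {ω | ∀ x₁ x₂, φ t t₀ x₁ ω = φ t t₀ x₂ ω}

end NRDS

/-! ### Poisson processes on the real line -/

section Poisson

variable {Ω : Type*} [MeasurableSpace Ω]

/-- The number of points of `S ω` in `A`. -/
def count (S : Ω → Set ℝ) (A : Set ℝ) (ω : Ω) : ℕ∞ := (S ω ∩ A).encard

/-- Homogeneous Poisson process on `ℝ` with rate `c`; on sets of infinite Lebesgue measure the
number of points is almost surely infinite. -/
structure IsPoissonProcess (P : Measure Ω) (c : ℝ) (S : Ω → Set ℝ) : Prop where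
  countable : ∀ ω, (S ω).Countable
  measurable_count : ∀ A, MeasurableSet A → Measurable (count S A)
  indep_count : ∀ (p : ℕ) (A : Fin p → Set ℝ), (∀ i, MeasurableSet (A i)) →
    Pairwise (fun i j => Disjoint (A i) (A j)) → iIndepFun (fun i => count S (A i)) P
  law_count : ∀ A, MeasurableSet A → volume A ≠ ⊤ → ∀ k : ℕ,
    P.real {ω | count S A ω = k} =
      (c * volume.real A) ^ k / k.factorial * Real.exp (-(c * volume.real A))
  law_count_top : ∀ A, MeasurableSet A → volume A = ⊤ → ∀ᵐ ω ∂P, count S A ω = ⊤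

/-- `M(t) = ∫₀ᵗ rate(s) ds`. -/
def cumulative (rate : ℝ → ℝ) (t : ℝ) : ℝ := ∫ s in (0 : ℝ)..t, rate s

/-- Non-homogeneous Poisson process with (locally integrable, non-negative) rate function:
its image under `M` is a homogeneous Poisson process with rate `1`. -/
def IsNonhomogeneousPoisson (P : Measure Ω) (rate : ℝ → ℝ) (S : Ω → Set ℝ) : Prop :=
  IsPoissonProcess P 1 (fun ω => cumulative rate '' S ω)

/-- The σ-algebra generated by the numbers of points of `S` in the Borel sets. -/
@[reducible] def generatedBy (S : Ω → Set ℝ) : MeasurableSpace Ω :=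
  ⨆ A : {A : Set ℝ // MeasurableSet A}, MeasurableSpace.comap (count S A.1) inferInstance

/-- The random clocks of TASEP with `n` sites: `n + 1` independent non-homogeneous Poisson
processes, `points k` being the jump (attempt) times of clock `k`. The last three fields express
that the usual null events are removed from the sample space: for each `ω` the jump times do not
accumulate, no clock rings at a time at which `M` has a value that it takes more than once, and
no two clocks ring simultaneously. -/
structure Clocks (P : Measure Ω) (n : ℕ) (rate : Fin (n + 1) → ℝ → ℝ) where
  points : Fin (n + 1) → Ω → Set ℝ
  poisson : ∀ k, IsNonhomogeneousPoisson P (rate k) (points k)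
  indep : iIndep (fun k => generatedBy (points k)) P
  locallyFinite : ∀ k ω a b, (points k ω ∩ Icc a b).Finite
  noPlateau : ∀ k ω, ∀ s ∈ points k ω, ∀ u,
    cumulative (rate k) u = cumulative (rate k) s → u = s
  distinct : ∀ ω, ∀ k l, k ≠ l → Disjoint (points k ω) (points l ω)

end Poisson

/-! ### TASEP -/

/-- The state space `{0,1}ⁿ`; coordinate `j : Fin n` is the occupation of site `j + 1`. -/
def Config (n : ℕ) : Type := Fin n → Bool

/-- The discrete metric: distinct states have distance `1`. -/
instance (n : ℕ) : MetricSpace (Config n) := by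
  classical
  exact
  { dist := fun x y => if x = y then 0 else 1
    dist_self := fun x => by simp
    dist_comm := fun x y => by simp only [eq_comm]
    dist_triangle := fun x y z => by
      by_cases h₁ : x = y <;> by_cases h₂ : y = z <;> by_cases h₃ : x = z <;> simp_all
    eq_of_dist_eq_zero := fun {x y} h => by
      by_contra hne
      simp [hne] at h }

instance (n : ℕ) : Finite (Config n) := inferInstanceAs (Finite (Fin n → Bool))

instance (n : ℕ) : MeasurableSpace (Config n) := borel _

instance (n : ℕ) : BorelSpace (Config n) := ⟨rfl⟩

/-- The map `f(x, k)`: effect on `x` of a jump attempt of clock `k`. For `0 < k < n` the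
coordinates `i = k - 1` and `j = k` belong to the sites `k` and `k + 1`. -/
def hopFun {n : ℕ} (x : Fin n → Bool) (k : Fin (n + 1)) : Fin n → Bool :=
  if k.val = 0 then fun j => if j.val = 0 then true else x j
  else if k.val = n then fun j => if j.val + 1 = n then false else x j
  else if ∃ i j : Fin n, i.val + 1 = k.val ∧ j.val = k.val ∧ x i = true ∧ x j = false then
    fun j => if j.val + 1 = k.val then false else if j.val = k.val then true else x j
  else x

/-- `hopFun` as a map on the state space. -/
def hop {n : ℕ} (x : Config n) (k : Fin (n + 1)) : Config n := hopFun x k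

section Flow

variable {Ω : Type*} [MeasurableSpace Ω] {P : Measure Ω} {n : ℕ} {rate : Fin (n + 1) → ℝ → ℝ}

/-- The jump attempts `(s, k)` (clock `k` rings at time `s`) with `s ∈ [t₀, t)`. -/
def Clocks.jumpSet (c : Clocks P n rate) (t t₀ : ℝ) (ω : Ω) : Set (ℝ ×ₗ Fin (n + 1)) :=
  {p | (ofLex p).1 ∈ Ico t₀ t ∧ (ofLex p).1 ∈ c.points (ofLex p).2 ω}

theorem Clocks.jumpSet_finite (c : Clocks P n rate) (t t₀ : ℝ) (ω : Ω) :
    (c.jumpSet t t₀ ω).Finite := by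
  have h : (⋃ k : Fin (n + 1), (fun s : ℝ => toLex (s, k)) '' (c.points k ω ∩ Icc t₀ t)).Finite :=
    Set.finite_iUnion fun k => (c.locallyFinite k ω t₀ t).image _
  refine h.subset fun p hp => ?_
  refine mem_iUnion.2 ⟨(ofLex p).2, (ofLex p).1, ⟨hp.2, hp.1.1, hp.1.2.le⟩, rfl⟩

/-- The jump attempts in `[t₀, t)` in chronological order (their times are distinct, so the
lexicographic order is the order of the times). -/
def Clocks.jumpList (c : Clocks P n rate) (t t₀ : ℝ) (ω : Ω) : List (ℝ ×ₗ Fin (n + 1)) :=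
  (c.jumpSet_finite t t₀ ω).toFinset.sort (· ≤ ·)

/-- The TASEP solution `φ(t, t₀, x, ω)`: apply the jump attempts in `[t₀, t)` one after the
other to `x`. -/
def Clocks.flow (c : Clocks P n rate) (t t₀ : ℝ) (x : Config n) (ω : Ω) : Config n :=
  (c.jumpList t t₀ ω).foldl (fun y p => hop y (ofLex p).2) x

end Flow

/-- Joint `(r, R, m)`-bounded rates on `[τ₁, τ₂)`: there is a division of the interval into `m`
subintervals over each of which the integral of each rate lies in `[r, R]`. -/
def JointlyBoundedRates {n : ℕ} (rate : Fin (n + 1) → ℝ → ℝ) (r R : ℝ) (m : ℕ) (τ₁ τ₂ : ℝ) :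
    Prop :=
  ∃ q : Fin (m + 1) → ℝ, StrictMono q ∧ q 0 = τ₁ ∧ q (Fin.last m) = τ₂ ∧
    ∀ (i : Fin m) (k : Fin (n + 1)),
      r ≤ ∫ t in (q i.castSucc)..(q i.succ), rate k t ∧
      ∫ t in (q i.castSucc)..(q i.succ), rate k t ≤ R

end TASEP

end

noncomputable section

namespace TASEP

/-! The flow synchronizes because some word of `n (n + 1) / 2` attempts takes every configuration to
the fully occupied one (`exists_synchronizing`). Once the first `b` sites are full, the only
possible hole among the first `b + 1` is at site `b + 1`; the attempts `b, b - 1, ..., 0` carry it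
to the left end and fill it.

Repeated attempts of one clock act as a single one, so one letter of the word is realized by a time
interval in which only that clock rings. Over one period all rates have integrals between positive
bounds, so this event has probability bounded below, uniformly in the interval; over disjoint
intervals such events are independent. Grouping the intervals into blocks as long as the word, each
block synchronizes with probability at least some `ε > 0`. Since synchronization persists, failure
through `N` blocks has probability at most `(1 - ε) ^ N`
(`Clocks.exists_forall_one_sub_syncEvent_le`), whence the exponential bound.

The attractor needs no probability: as `t₀` decreases, the images of the finite state space decrease
and stabilize, which yields invariance and pullback attraction for every `ω`
(`Clocks.eventually_imageSet_eq`). The exponential bound then gives singleton sections and forward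
attraction, because a synchronized image equals the section of the attractor.

Measurability comes from writing the flow as a pointwise limit of functions of finitely many point
counts, and then using its left continuity in both times. -/

instance (n : ℕ) : Nonempty (Config n) := inferInstanceAs (Nonempty (Fin n → Bool))

instance (n : ℕ) : DiscreteTopology (Config n) :=
  DiscreteTopology.of_forall_le_dist one_pos fun x y hxy => by
    simp [dist, hxy]

/-! ### Combinatorics of ordered attempts and the synchronizing word -/

theorem sort_union_of_lt {α : Type*} [LinearOrder α] {s t u : Finset α}
    (hu : ∀ a, a ∈ u ↔ a ∈ s ∨ a ∈ t) (h : ∀ a ∈ s, ∀ b ∈ t, a < b) :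
    u.sort (· ≤ ·) = s.sort (· ≤ ·) ++ t.sort (· ≤ ·) := by
  refine List.Perm.eq_of_pairwise' (r := (· ≤ ·)) (Finset.pairwise_sort _ _) ?_ ?_
  · refine List.pairwise_append.2 ⟨Finset.pairwise_sort _ _, Finset.pairwise_sort _ _, ?_⟩
    intro a ha b hb
    exact (h a ((Finset.mem_sort _).1 ha) b ((Finset.mem_sort _).1 hb)).le
  · refine (List.perm_ext_iff_of_nodup (Finset.sort_nodup _ _) ?_).2 fun a => by simp [hu]
    refine List.nodup_append.2 ⟨Finset.sort_nodup _ _, Finset.sort_nodup _ _, ?_⟩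
    intro a ha b hb
    exact (h a ((Finset.mem_sort _).1 ha) b ((Finset.mem_sort _).1 hb)).ne

/-- Idempotence is why only the set of clocks that ring matters, not how often, when a single clock
rings in an interval. -/
theorem hopFun_hopFun {n : ℕ} (x : Fin n → Bool) (k : Fin (n + 1)) :
    hopFun (hopFun x k) k = hopFun x k := by
  by_cases h0 : k.val = 0
  · simp only [hopFun, if_pos h0]; funext j; split_ifs <;> rfl
  by_cases hn : k.val = n
  · simp only [hopFun, if_neg h0, if_pos hn]; funext j; split_ifs <;> rfl
  by_cases h : ∃ i j : Fin n, i.val + 1 = k.val ∧ j.val = k.val ∧ x i = true ∧ x j = false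
  · have hx : hopFun x k =
        fun j => if j.val + 1 = k.val then false else if j.val = k.val then true else x j := by
      rw [hopFun, if_neg h0, if_neg hn, if_pos h]
    rw [hx, hopFun, if_neg h0, if_neg hn, if_neg]
    rintro ⟨i, j, hi, hj, hxi, hxj⟩
    simp [hi] at hxi
  · have hx : hopFun x k = x := by rw [hopFun, if_neg h0, if_neg hn, if_neg h]
    rw [hx, hx]

theorem hop_hop {n : ℕ} (x : Config n) (k : Fin (n + 1)) : hop (hop x k) k = hop x k :=
  hopFun_hopFun x k

/-- An attempt of clock `k < n` moves a hole among the first `b` sites from site `k + 1` to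
site `k`. -/
theorem hopFun_hole {n b : ℕ} (x : Fin n → Bool) (k : Fin (n + 1)) (hk : k.val < b) (hb : b ≤ n)
    (hx : ∀ j : Fin n, j.val < b → j.val ≠ k.val → x j = true) (j : Fin n) (hj : j.val < b)
    (hjk : j.val + 1 ≠ k.val) : hopFun x k j = true := by
  by_cases h0 : k.val = 0
  · rw [hopFun, if_pos h0]
    by_cases hj0 : j.val = 0
    · exact if_pos hj0
    · exact (if_neg hj0).trans (hx j hj (by omega))
  have hn : k.val ≠ n := by omega
  rw [hopFun, if_neg h0, if_neg hn]
  split_ifs with h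
  · dsimp only
    rw [if_neg hjk]
    by_cases hj' : j.val = k.val
    · exact if_pos hj'
    · exact (if_neg hj').trans (hx j hj hj')
  · by_cases hj' : j.val = k.val
    · by_contra hxj
      exact h ⟨⟨k.val - 1, by omega⟩, j, by dsimp only; omega, hj',
        hx _ (by dsimp only; omega) (by dsimp only; omega), by simpa using hxj⟩
    · exact hx j hj hj'

/-- The word is `k, k - 1, ..., 0`: each attempt shifts the possible hole one coordinate down, and
clock `0` fills it. If there is no hole, these attempts leave the first `b` coordinates full. -/
theorem exists_fill_hole {n b : ℕ} (hb : b ≤ n) (k : ℕ) (hk : k < b) :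
    ∃ l : List (Fin (n + 1)), l.length = k + 1 ∧ ∀ x : Fin n → Bool,
      (∀ j : Fin n, j.val < b → j.val ≠ k → x j = true) →
        ∀ j : Fin n, j.val < b → l.foldl hopFun x j = true := by
  induction k with
  | zero =>
    refine ⟨[0], rfl, fun x hx j hj => ?_⟩
    exact hopFun_hole x 0 hk hb (fun j hj hj' => hx j hj hj') j hj (Nat.succ_ne_zero _)
  | succ k ih =>
    obtain ⟨l, hl, h⟩ := ih (by omega)
    refine ⟨⟨k + 1, by omega⟩ :: l, by simp [hl], fun x hx j hj => ?_⟩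
    rw [List.foldl_cons]
    refine h _ (fun i hi hik => ?_) j hj
    exact hopFun_hole x _ hk hb hx i hi (by simpa using hik)

/-- Lengthening the full initial segment by its `b`-th site costs `b` attempts, so the total length
is `1 + 2 + ... + b`. -/
theorem exists_fill {n : ℕ} (b : ℕ) (hb : b ≤ n) :
    ∃ l : List (Fin (n + 1)), l.length = b * (b + 1) / 2 ∧ ∀ x : Fin n → Bool,
      ∀ j : Fin n, j.val < b → l.foldl hopFun x j = true := by
  induction b with
  | zero => exact ⟨[], rfl, fun x j hj => absurd hj (Nat.not_lt_zero _)⟩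
  | succ b ih =>
    obtain ⟨l, hl, h⟩ := ih (by omega)
    obtain ⟨l', hl', h'⟩ := exists_fill_hole hb b (by omega)
    refine ⟨l ++ l', ?_, fun x j hj => ?_⟩
    · rw [List.length_append, hl, hl',
        show (b + 1) * (b + 1 + 1) = b * (b + 1) + (b + 1) * 2 by ring,
        Nat.add_mul_div_right _ _ two_pos]
    · rw [List.foldl_append]
      exact h' _ (fun i hi hib => h x i (by omega)) j hj

/-- A sequence of `n (n + 1) / 2` attempts that fills all sites. -/
theorem exists_synchronizing (n : ℕ) :
    ∃ κ : ℕ → Fin (n + 1), ∀ x y : Config n,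
      ((List.range (n * (n + 1) / 2)).map κ).foldl hop x =
        ((List.range (n * (n + 1) / 2)).map κ).foldl hop y := by
  obtain ⟨l, hl, h⟩ := exists_fill n le_rfl
  -- The default `0` is never read, since only indices below the length of `l` are used.
  refine ⟨fun i => l.getD i 0, fun x y => ?_⟩
  have e : (List.range (n * (n + 1) / 2)).map (fun i => l.getD i 0) = l := by
    refine List.ext_getElem (by simp [hl]) fun i h₁ h₂ => ?_
    simp [h₂]
  rw [e]
  exact funext fun j => (h x j j.isLt).trans (h y j j.isLt).symm

theorem foldl_hop_eq {n : ℕ} {α : Type*} (g : α → Fin (n + 1)) (k : Fin (n + 1)) (l : List α)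
    (hl : l ≠ []) (h : ∀ p ∈ l, g p = k) (x : Config n) :
    l.foldl (fun y p => hop y (g p)) x = hop x k := by
  induction l generalizing x with
  | nil => exact absurd rfl hl
  | cons a l ih =>
    rw [List.foldl_cons, h a (by simp)]
    by_cases hl' : l = []
    · subst hl'; rfl
    · rw [ih hl' fun p hp => h p (by simp [hp]), hop_hop]

/-! ### The flow: cocycle property and gaps between jump times -/

section Flow

variable {Ω : Type*} [MeasurableSpace Ω] {P : Measure Ω} {n : ℕ} {rate : Fin (n + 1) → ℝ → ℝ}
  (c : Clocks P n rate)

theorem Clocks.mem_jumpList {t t₀ : ℝ} {ω : Ω} {p : ℝ ×ₗ Fin (n + 1)} :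
    p ∈ c.jumpList t t₀ ω ↔
      (ofLex p).1 ∈ Ico t₀ t ∧ (ofLex p).1 ∈ c.points (ofLex p).2 ω := by
  simp [jumpList, jumpSet]

theorem Clocks.jumpList_append {t s t₀ : ℝ} (h₁ : t₀ ≤ s) (h₂ : s ≤ t) (ω : Ω) :
    c.jumpList t t₀ ω = c.jumpList s t₀ ω ++ c.jumpList t s ω := by
  refine sort_union_of_lt (fun p => ?_) fun p hp q hq => ?_
  · simp only [Set.Finite.mem_toFinset, jumpSet, mem_ofPred_eq, mem_Ico]
    constructor
    · rintro ⟨⟨h, h'⟩, hp⟩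
      rcases lt_or_ge (ofLex p).1 s with hs | hs
      · exact Or.inl ⟨⟨h, hs⟩, hp⟩
      · exact Or.inr ⟨⟨hs, h'⟩, hp⟩
    · rintro (⟨⟨h, h'⟩, hp⟩ | ⟨⟨h, h'⟩, hp⟩)
      · exact ⟨⟨h, h'.trans_le h₂⟩, hp⟩
      · exact ⟨⟨h₁.trans h, h'⟩, hp⟩
  · simp only [Set.Finite.mem_toFinset, jumpSet, mem_ofPred_eq, mem_Ico] at hp hq
    exact Prod.Lex.lt_iff.2 (Or.inl (hp.1.2.trans_le hq.1.1))

theorem Clocks.flow_cocycle (t s t₀ : ℝ) (h₁ : t₀ ≤ s) (h₂ : s ≤ t) (x : Config n) (ω : Ω) :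
    c.flow t t₀ x ω = c.flow t s (c.flow s t₀ x ω) ω := by
  simp only [flow, c.jumpList_append h₁ h₂, List.foldl_append]

theorem Clocks.flow_eq_self {t t₀ : ℝ} {ω : Ω}
    (h : ∀ k, c.points k ω ∩ Ico t₀ t = ∅) (x : Config n) : c.flow t t₀ x ω = x := by
  have : c.jumpList t t₀ ω = [] := by
    refine List.eq_nil_iff_forall_not_mem.2 fun p hp => ?_
    rw [c.mem_jumpList] at hp
    exact (h (ofLex p).2).subset ⟨hp.2, hp.1⟩
  rw [flow, this, List.foldl_nil]

theorem Clocks.flow_self (t : ℝ) (x : Config n) (ω : Ω) : c.flow t t x ω = x :=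
  c.flow_eq_self (by simp) x

/-- On an interval in which a single clock rings, the flow is one attempt of that clock. -/
theorem Clocks.flow_eq_hop {t t₀ : ℝ} {ω : Ω} (k : Fin (n + 1))
    (hk : (c.points k ω ∩ Ico t₀ t).Nonempty)
    (h : ∀ l, l ≠ k → c.points l ω ∩ Ico t₀ t = ∅) (x : Config n) :
    c.flow t t₀ x ω = hop x k := by
  refine foldl_hop_eq (fun p : ℝ ×ₗ Fin (n + 1) => (ofLex p).2) k _ ?_ (fun p hp => ?_) x
  · obtain ⟨s, hs, hs'⟩ := hk
    have : toLex (s, k) ∈ c.jumpList t t₀ ω := c.mem_jumpList.2 ⟨hs', hs⟩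
    exact List.ne_nil_of_mem this
  · rw [c.mem_jumpList] at hp
    by_contra hne
    exact (h _ hne).subset ⟨hp.2, hp.1⟩

/-- Since jump times do not accumulate, this holds at every `s`. With the half-open convention `[t₀,
t)` it makes the flow left continuous in both times. -/
theorem Clocks.exists_left_gap (s : ℝ) (ω : Ω) :
    ∃ δ > 0, ∀ k, c.points k ω ∩ Ico (s - δ) s = ∅ := by
  have hfin : (⋃ k, c.points k ω ∩ Ico (s - 1) s).Finite :=
    Set.finite_iUnion fun k =>
      (c.locallyFinite k ω (s - 1) s).subset (inter_subset_inter_right _ Ico_subset_Icc_self)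
  have hs : ∀ᶠ u in 𝓝[<] s, ∀ v ∈ ⋃ k, c.points k ω ∩ Ico (s - 1) s, v < u := by
    rw [Filter.eventually_all_finite hfin]
    intro v hv
    obtain ⟨k, hk⟩ := mem_iUnion.1 hv
    filter_upwards [Ioo_mem_nhdsLT hk.2.2] with u hu using hu.1
  have hs' : ∀ᶠ u in 𝓝[<] s, u ∈ Ioo (s - 1) s := Ioo_mem_nhdsLT (by linarith)
  obtain ⟨u, hu, hu'⟩ := (hs.and hs').exists
  refine ⟨s - u, by linarith [hu'.2], fun k => eq_empty_of_forall_notMem fun v hv => ?_⟩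
  have h1 : u ≤ v := by linarith [hv.2.1]
  exact absurd (hu v (mem_iUnion.2 ⟨k, hv.1, hu'.1.le.trans h1, hv.2.2⟩)) h1.not_gt

theorem Clocks.flow_eq_of_gap {δ s u : ℝ} {ω : Ω}
    (h : ∀ k, c.points k ω ∩ Ico (s - δ) s = ∅) (hu : s - δ ≤ u) (x : Config n) :
    c.flow s u x ω = x :=
  c.flow_eq_self (fun k => subset_eq_empty
    (inter_subset_inter_right _ (Ico_subset_Ico_left hu)) (h k)) x

/-- A positive lower bound for the distances between distinct jump times in `[t₀, t)`. -/
theorem Clocks.exists_gap (t t₀ : ℝ) (ω : Ω) :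
    ∃ δ > 0, ∀ k l, ∀ u ∈ c.points k ω ∩ Ico t₀ t, ∀ v ∈ c.points l ω ∩ Ico t₀ t,
      |u - v| < δ → k = l := by
  have hfin : (⋃ k, c.points k ω ∩ Ico t₀ t).Finite :=
    Set.finite_iUnion fun k =>
      (c.locallyFinite k ω t₀ t).subset (inter_subset_inter_right _ Ico_subset_Icc_self)
  have : ∀ᶠ δ : ℝ in 𝓝[>] 0, ∀ u ∈ ⋃ k, c.points k ω ∩ Ico t₀ t,
      ∀ v ∈ ⋃ k, c.points k ω ∩ Ico t₀ t, |u - v| < δ → u = v := by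
    rw [Filter.eventually_all_finite hfin]
    intro u _
    rw [Filter.eventually_all_finite hfin]
    intro v _
    by_cases huv : u = v
    · exact Filter.Eventually.of_forall fun _ _ => huv
    · filter_upwards [Ioo_mem_nhdsGT (abs_pos.2 (sub_ne_zero.2 huv))] with δ hδ h
      exact absurd h hδ.2.not_gt
  obtain ⟨δ, hδ, hδ0⟩ := (this.and self_mem_nhdsWithin).exists
  refine ⟨δ, hδ0, fun k l u hu v hv huv => ?_⟩
  have := hδ u (mem_iUnion.2 ⟨k, hu⟩) v (mem_iUnion.2 ⟨l, hv⟩) huv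
  subst this
  by_contra hkl
  exact (c.distinct ω k l hkl).le_bot ⟨hu.1, hv.1⟩

end Flow

/-! ### The time change by the cumulative rate -/

section Cumulative

variable {r : ℝ → ℝ}

theorem cumulative_sub (hr : ∀ a b, IntervalIntegrable r volume a b) (a b : ℝ) :
    cumulative r b - cumulative r a = ∫ s in a..b, r s :=
  intervalIntegral.integral_interval_sub_left (hr 0 b) (hr 0 a)

theorem cumulative_mono (hr : ∀ a b, IntervalIntegrable r volume a b) (h0 : ∀ t, 0 ≤ r t) :
    Monotone (cumulative r) := fun a b hab => by
  rw [← sub_nonneg, cumulative_sub hr]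
  exact intervalIntegral.integral_nonneg hab fun u _ => h0 u

/-- Counting points in `[a, b)` amounts to counting their images under a monotone map whose
plateaus they avoid. -/
theorem encard_image_inter_Ico {M : ℝ → ℝ} (hM : Monotone M) {S : Set ℝ}
    (hS : ∀ s ∈ S, ∀ u, M u = M s → u = s) (a b : ℝ) :
    (M '' S ∩ Ico (M a) (M b)).encard = (S ∩ Ico a b).encard := by
  have h1 : M '' S ∩ Ico (M a) (M b) = M '' (S ∩ Ico a b) := by
    ext y
    constructor
    · rintro ⟨⟨s, hs, rfl⟩, h, h'⟩
      refine ⟨s, ⟨hs, ?_, hM.reflect_lt h'⟩, rfl⟩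
      -- If `s < a`, then monotonicity forces `M s = M a`, a plateau through the point `s`.
      by_contra hlt
      exact hlt (hS s hs a (le_antisymm h (hM (not_le.1 hlt).le))).le
    · rintro ⟨s, ⟨hs, h, h'⟩, rfl⟩
      refine ⟨⟨s, hs, rfl⟩, hM h, (hM h'.le).lt_of_ne fun he => ?_⟩
      exact h'.ne' (hS s hs b he.symm)
  rw [h1]
  exact InjOn.encard_image fun s hs u _ h => (hS s hs.1 u h.symm).symm

end Cumulative

/-! ### Measurability of the flow -/

section Measurability

variable {Ω : Type*} [MeasurableSpace Ω] {P : Measure Ω} {n : ℕ} {rate : Fin (n + 1) → ℝ → ℝ}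
  (c : Clocks P n rate)

theorem Clocks.count_Ico (hr : ∀ k a b, IntervalIntegrable (rate k) volume a b)
    (h0 : ∀ k t, 0 ≤ rate k t) (k : Fin (n + 1)) (a b : ℝ) (ω : Ω) :
    count (c.points k) (Ico a b) ω = count (fun ω => cumulative (rate k) '' c.points k ω)
      (Ico (cumulative (rate k) a) (cumulative (rate k) b)) ω :=
  (encard_image_inter_Ico (cumulative_mono (hr k) (h0 k)) (c.noPlateau k ω) a b).symm

theorem Clocks.measurable_count_Ico (hr : ∀ k a b, IntervalIntegrable (rate k) volume a b)
    (h0 : ∀ k t, 0 ≤ rate k t) (k : Fin (n + 1)) (a b : ℝ) :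
    Measurable (count (c.points k) (Ico a b)) := by
  rw [funext (c.count_Ico hr h0 k a b)]
  exact (c.poisson k).measurable_count _ measurableSet_Ico

/-- The clocks that ring in `[a, b)`. -/
def Clocks.ringing (c : Clocks P n rate) (b a : ℝ) (ω : Ω) : Set (Fin (n + 1)) :=
  {k | (c.points k ω ∩ Ico a b).Nonempty}

theorem Clocks.mem_ringing_iff {k : Fin (n + 1)} {a b : ℝ} {ω : Ω} :
    k ∈ c.ringing b a ω ↔ count (c.points k) (Ico a b) ω ≠ 0 := by
  rw [count, Set.encard_ne_zero]; rfl

theorem Clocks.measurable_ringing (hr : ∀ k a b, IntervalIntegrable (rate k) volume a b)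
    (h0 : ∀ k t, 0 ≤ rate k t) (b a : ℝ) : Measurable (c.ringing b a) := by
  refine measurable_set_iff.2 fun k => ?_
  simp only [c.mem_ringing_iff]
  exact (MeasurableSet.of_discrete (s := {x : ℕ∞ | x ≠ 0})).mem.comp
    (c.measurable_count_Ico hr h0 k a b)

/-- One attempt of some clock in `K`, if there is one. -/
def hopSome {n : ℕ} (K : Set (Fin (n + 1))) (x : Config n) : Config n :=
  open Classical in if h : K.Nonempty then hop x h.some else x

theorem Clocks.flow_eq_hopSome {b a : ℝ} {ω : Ω} (h : (c.ringing b a ω).Subsingleton)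
    (x : Config n) : c.flow b a x ω = hopSome (c.ringing b a ω) x := by
  unfold hopSome
  split_ifs with hne
  · refine c.flow_eq_hop _ hne.some_mem (fun l hl => ?_) x
    by_contra hl'
    exact hl (h (nonempty_iff_ne_empty.2 hl') hne.some_mem)
  · refine c.flow_eq_self (fun k => ?_) x
    by_contra hk
    exact hne ⟨k, nonempty_iff_ne_empty.2 hk⟩

/-- The flow through `j` steps of length `h` in which at most one attempt per step is made. -/
def Clocks.stepFlow (c : Clocks P n rate) (t₀ h : ℝ) (x : Config n) : ℕ → Ω → Config n
  | 0, _ => x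
  | j + 1, ω => hopSome (c.ringing (t₀ + (j + 1 : ℕ) * h) (t₀ + j * h) ω) (c.stepFlow t₀ h x j ω)

theorem Clocks.measurable_stepFlow (hr : ∀ k a b, IntervalIntegrable (rate k) volume a b)
    (h0 : ∀ k t, 0 ≤ rate k t) (t₀ h : ℝ) (x : Config n) (j : ℕ) :
    Measurable (c.stepFlow t₀ h x j) := by
  induction j with
  | zero => exact measurable_const
  | succ j ih =>
    exact (Measurable.of_discrete (f := fun p : Set (Fin (n + 1)) × Config n =>
      hopSome p.1 p.2)).comp ((c.measurable_ringing hr h0 _ _).prodMk ih)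

/-- When the step is shorter than the gap between different clocks' points, each step sees at most
one clock, so the choice inside `hopSome` is forced. -/
theorem Clocks.flow_eq_stepFlow {t t₀ h δ : ℝ} {ω : Ω} (hh : 0 ≤ h) (hδ : h < δ)
    (hgap : ∀ k l, ∀ u ∈ c.points k ω ∩ Ico t₀ t, ∀ v ∈ c.points l ω ∩ Ico t₀ t,
      |u - v| < δ → k = l) (x : Config n) (j : ℕ) (hj : t₀ + j * h ≤ t) :
    c.flow (t₀ + j * h) t₀ x ω = c.stepFlow t₀ h x j ω := by
  induction j with
  | zero => simpa [stepFlow] using c.flow_self t₀ x ω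
  | succ j ih =>
    have h1 : t₀ + (j + 1 : ℕ) * h = t₀ + j * h + h := by push_cast; ring
    have h2 : t₀ ≤ t₀ + j * h := by have : 0 ≤ j * h := by positivity
                                    linarith
    rw [c.flow_cocycle _ (t₀ + j * h) t₀ h2 (by linarith), ih (by linarith), stepFlow,
      c.flow_eq_hopSome]
    rintro k ⟨u, hu, hu'⟩ l ⟨v, hv, hv'⟩
    refine hgap k l u ⟨hu, h2.trans hu'.1, hu'.2.trans_le hj⟩ v
      ⟨hv, h2.trans hv'.1, hv'.2.trans_le hj⟩ (abs_lt.2 ⟨?_, ?_⟩)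
    · linarith [hu'.1, hv'.2]
    · linarith [hv'.1, hu'.2]

/-- Step flows are measurable, depending only on which clocks ring in finitely many intervals. For
each `ω` they agree with the flow once the mesh is below the gap. -/
theorem Clocks.measurable_flow_apply (hr : ∀ k a b, IntervalIntegrable (rate k) volume a b)
    (h0 : ∀ k t, 0 ≤ rate k t) (t t₀ : ℝ) (x : Config n) :
    Measurable (c.flow t t₀ x) := by
  rcases lt_or_ge t t₀ with htt | htt
  · have : c.flow t t₀ x = fun _ => x :=
      funext fun ω => c.flow_eq_self (by simp [Ico_eq_empty_of_le htt.le]) x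
    rw [this]
    exact measurable_const
  refine measurable_of_tendsto_metrizable
    (f := fun (N : ℕ) => c.stepFlow t₀ ((t - t₀) / ((N : ℝ) + 1)) x (N + 1))
    (fun N => c.measurable_stepFlow hr h0 _ _ _ _) (tendsto_pi_nhds.2 fun ω => ?_)
  obtain ⟨δ, hδ, hgap⟩ := c.exists_gap t t₀ ω
  have hlim : Tendsto (fun N : ℕ => (t - t₀) / ((N : ℝ) + 1)) atTop (𝓝 0) := by
    simpa [div_eq_mul_inv] using
      (tendsto_one_div_add_atTop_nhds_zero_nat (𝕜 := ℝ)).const_mul (t - t₀)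
  refine tendsto_nhds_of_eventually_eq ?_
  filter_upwards [hlim.eventually (gt_mem_nhds hδ)] with N hN
  have hN' : t₀ + ((N + 1 : ℕ) : ℝ) * ((t - t₀) / ((N : ℝ) + 1)) = t := by
    push_cast; field_simp; ring
  rw [← c.flow_eq_stepFlow (div_nonneg (by linarith) (by positivity)) hN hgap x _ hN'.le, hN']

/-- A lattice point to the left of `s`, at distance at most `1 / (N + 1)`. -/
def leftApprox (N : ℕ) (s : ℝ) : ℝ := ((⌈s * (N + 1)⌉ : ℝ) - 1) / (N + 1)

theorem leftApprox_lt (N : ℕ) (s : ℝ) : leftApprox N s < s := by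
  rw [leftApprox, div_lt_iff₀ (by positivity)]
  linarith [Int.ceil_lt_add_one (s * ((N : ℝ) + 1))]

theorem sub_le_leftApprox (N : ℕ) (s : ℝ) : s - 1 / (N + 1) ≤ leftApprox N s := by
  rw [leftApprox, le_div_iff₀ (by positivity), sub_mul, one_div_mul_cancel (by positivity)]
  linarith [Int.le_ceil (s * ((N : ℝ) + 1))]

theorem leftApprox_mono (N : ℕ) {s t : ℝ} (h : s ≤ t) : leftApprox N s ≤ leftApprox N t := by
  unfold leftApprox
  gcongr

theorem Clocks.eventually_flow_leftApprox {t t₀ : ℝ} (h : t₀ ≤ t) (x : Config n) (ω : Ω) :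
    ∀ᶠ N : ℕ in atTop,
      c.flow (leftApprox N t) (leftApprox N t₀) x ω = c.flow t t₀ x ω := by
  obtain ⟨δ, hδ, hgap⟩ := c.exists_left_gap t ω
  obtain ⟨δ', hδ', hgap'⟩ := c.exists_left_gap t₀ ω
  have hlim := tendsto_one_div_add_atTop_nhds_zero_nat (𝕜 := ℝ)
  filter_upwards [hlim.eventually (gt_mem_nhds hδ), hlim.eventually (gt_mem_nhds hδ')] with N hN hN'
  have h1 := sub_le_leftApprox N t
  have h2 := sub_le_leftApprox N t₀
  have e1 : c.flow t (leftApprox N t₀) x ω = c.flow t t₀ x ω := by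
    rw [c.flow_cocycle t t₀ _ (leftApprox_lt N t₀).le h, c.flow_eq_of_gap hgap' (by linarith)]
  rw [← e1, c.flow_cocycle t (leftApprox N t) _ (leftApprox_mono N h) (leftApprox_lt N t).le,
    c.flow_eq_of_gap hgap (by linarith)]

/-- At lattice times only countably many triples of two times and a state occur, so measurability in
`ω` suffices. Left continuity recovers the flow as the lattice is refined. -/
theorem Clocks.measurable_flow (hr : ∀ k a b, IntervalIntegrable (rate k) volume a b)
    (h0 : ∀ k t, 0 ≤ rate k t) :
    Measurable (fun p : {q : ℝ × ℝ // q.2 ≤ q.1} × Config n × Ω =>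
      c.flow p.1.1.1 p.1.1.2 p.2.1 p.2.2) := by
  refine measurable_of_tendsto_metrizable
    (f := fun (N : ℕ) (p : {q : ℝ × ℝ // q.2 ≤ q.1} × Config n × Ω) =>
      c.flow (leftApprox N p.1.1.1) (leftApprox N p.1.1.2) p.2.1 p.2.2) (fun N => ?_)
    (tendsto_pi_nhds.2 fun p => tendsto_nhds_of_eventually_eq
      (c.eventually_flow_leftApprox p.1.2 p.2.1 p.2.2))
  have hg : Measurable (fun q : Ω × (ℤ × ℤ × Config n) =>
      c.flow (((q.2.1 : ℝ) - 1) / (N + 1)) (((q.2.2.1 : ℝ) - 1) / (N + 1)) q.2.2.2 q.1) :=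
    measurable_from_prod_countable_left fun y => c.measurable_flow_apply hr h0
      (((y.1 : ℝ) - 1) / (N + 1)) (((y.2.1 : ℝ) - 1) / (N + 1)) y.2.2
  have hm : Measurable (fun p : {q : ℝ × ℝ // q.2 ≤ q.1} × Config n × Ω =>
      (p.2.2, ⌈p.1.1.1 * ((N : ℝ) + 1)⌉, ⌈p.1.1.2 * ((N : ℝ) + 1)⌉, p.2.1)) := by
    fun_prop
  exact hg.comp hm

theorem Clocks.isNRDS_flow (hr : ∀ k a b, IntervalIntegrable (rate k) volume a b)
    (h0 : ∀ k t, 0 ≤ rate k t) : IsNRDS c.flow where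
  measurable := c.measurable_flow hr h0
  identity := c.flow_self
  cocycle := c.flow_cocycle
  continuous _ _ _ _ := continuous_of_discreteTopology

end Measurability

/-! ### Independence over disjoint intervals and blocks -/

section Independence

variable {Ω : Type*} [MeasurableSpace Ω] {P : Measure Ω}

/-- Independence of the numbers of points in finitely many members of a disjoint sequence. -/
theorem IsPoissonProcess.measure_biInter {a : ℝ} {S : Ω → Set ℝ} (hS : IsPoissonProcess P a S)
    (A : ℕ → Set ℝ) (hA : ∀ i, MeasurableSet (A i))
    (hd : Pairwise (fun i j => Disjoint (A i) (A j))) (B : ℕ → Set ℕ∞) (s : Finset ℕ) :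
    P (⋂ i ∈ s, count S (A i) ⁻¹' B i) = ∏ i ∈ s, P (count S (A i) ⁻¹' B i) := by
  let e := s.equivFin.symm
  have h := (hS.indep_count s.card (fun j => A (e j)) (fun j => hA _)
    (fun i j hij => hd fun h => hij (e.injective (Subtype.ext h)))).meas_iInter
    (s := fun j => count S (A (e j)) ⁻¹' B (e j))
    (fun j => ⟨B (e j), MeasurableSet.of_discrete, rfl⟩)
  rw [e.surjective.iInter_comp (fun i : s => count S (A i) ⁻¹' B i), iInter_subtype,
    e.prod_comp (fun i : s => P (count S (A i) ⁻¹' B i)),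
    Finset.prod_coe_sort s (fun i => P (count S (A i) ⁻¹' B i))] at h
  exact h

theorem IsPoissonProcess.real_count_eq_zero {S : Ω → Set ℝ} (hS : IsPoissonProcess P 1 S)
    {a b : ℝ} (hab : a ≤ b) :
    P.real (count S (Ico a b) ⁻¹' {0}) = Real.exp (-(b - a)) := by
  have h := hS.law_count (Ico a b) measurableSet_Ico (by simp) 0
  simpa [hab, measureReal_def, preimage] using h

theorem iIndepSet.biInter_block {P : Measure Ω} {F : ℕ → Set Ω} (hF : ∀ i, MeasurableSet (F i))
    (h : iIndepSet F P) (m : ℕ) : iIndepSet (fun j => ⋂ l : Fin m, F (j * m + l)) P := by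
  rw [iIndepSet_iff_meas_biInter fun j => MeasurableSet.iInter fun l => hF _]
  intro s
  let g : ℕ × Fin m → ℕ := fun p => p.1 * m + p.2
  -- Division with remainder by `m` recovers the block and the position in it.
  have hg : Function.Injective g := by
    rintro ⟨i, k⟩ ⟨j, l⟩ hkl
    have hm : 0 < m := k.pos
    have h1 := congrArg (· / m) hkl
    have h2 := congrArg (· % m) hkl
    simp only [g, Nat.mul_add_mod_self_right, Nat.mod_eq_of_lt k.isLt, Nat.mod_eq_of_lt l.isLt] at h2
    simp only [g, mul_comm _ m, Nat.mul_add_div hm, Nat.div_eq_of_lt k.isLt, Nat.div_eq_of_lt l.isLt,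
      add_zero] at h1
    exact Prod.ext h1 (Fin.ext h2)
  have key : ∀ s : Finset ℕ, P (⋂ j ∈ s, ⋂ l : Fin m, F (j * m + l)) =
      ∏ j ∈ s, ∏ l : Fin m, P (F (j * m + l)) := by
    intro s
    have h1 := (h.precomp hg).meas_biInter (s ×ˢ Finset.univ)
    rw [Finset.prod_product] at h1
    refine Eq.trans ?_ h1
    congr 1
    ext ω
    simp only [mem_iInter, Finset.mem_product, Finset.mem_univ, and_true, Function.comp_apply]
    exact ⟨fun h p hp => h p.1 hp p.2, fun h j hj l => h (j, l) hj⟩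
  rw [key]
  refine Finset.prod_congr rfl fun j _ => ?_
  have := key {j}
  simpa using this.symm

theorem iIndepSet.measureReal_biInter_compl_le [IsProbabilityMeasure P] {G : ℕ → Set Ω}
    (hG : ∀ i, MeasurableSet (G i)) (h : iIndepSet G P) {ε : ℝ} (hε : ∀ j, ε ≤ P.real (G j))
    (N : ℕ) : P.real (⋂ j ∈ Finset.range N, (G j)ᶜ) ≤ (1 - ε) ^ N := by
  -- Independence of the generated σ-algebras covers the complements.
  have h1 := ((iIndepSet_iff_iIndep _ _).1 h).meas_biInter (S := Finset.range N)
    (s := fun j => (G j)ᶜ)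
    (fun j _ => MeasurableSet.compl (MeasurableSpace.measurableSet_generateFrom rfl))
  rw [measureReal_def, h1, ENNReal.toReal_prod]
  calc ∏ j ∈ Finset.range N, (P (G j)ᶜ).toReal ≤ ∏ j ∈ Finset.range N, (1 - ε) := by
        refine Finset.prod_le_prod (fun _ _ => ENNReal.toReal_nonneg) fun j _ => ?_
        have := probReal_compl_eq_one_sub (μ := P) (hG j)
        rw [measureReal_def] at this
        rw [this]
        linarith [hε j]
    _ = (1 - ε) ^ N := by simp

end Independence

/-! ### Probability of realizing the synchronizing word -/

section Blocks

variable {Ω : Type*} [MeasurableSpace Ω] {P : Measure Ω} {n : ℕ} {rate : Fin (n + 1) → ℝ → ℝ}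
  (c : Clocks P n rate)

/-- The event that `κ i` is the only clock ringing in `[q i, q (i + 1))`. -/
def Clocks.onlyRing (c : Clocks P n rate) (q : ℕ → ℝ) (κ : ℕ → Fin (n + 1)) (i : ℕ) : Set Ω :=
  {ω | c.ringing (q (i + 1)) (q i) ω = {κ i}}

/-- The numbers of points of clock `k` allowed if `l` is to be the only clock ringing. -/
def allowedCount {n : ℕ} (l k : Fin (n + 1)) : Set ℕ∞ := if k = l then {0}ᶜ else {0}

theorem Clocks.onlyRing_eq_iInter (q : ℕ → ℝ) (κ : ℕ → Fin (n + 1)) (i : ℕ) :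
    c.onlyRing q κ i =
      ⋂ k, count (c.points k) (Ico (q i) (q (i + 1))) ⁻¹' allowedCount (κ i) k := by
  ext ω
  simp only [onlyRing, mem_ofPred_eq, Set.ext_iff, mem_iInter, mem_preimage, c.mem_ringing_iff,
    mem_singleton_iff]
  refine forall_congr' fun k => ?_
  unfold allowedCount
  split_ifs with h <;> simp [h]

theorem Clocks.measurableSet_onlyRing (hr : ∀ k a b, IntervalIntegrable (rate k) volume a b)
    (h0 : ∀ k t, 0 ≤ rate k t) (q : ℕ → ℝ) (κ : ℕ → Fin (n + 1)) (i : ℕ) :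
    MeasurableSet (c.onlyRing q κ i) := by
  rw [c.onlyRing_eq_iInter]
  exact MeasurableSet.iInter fun k => c.measurable_count_Ico hr h0 k _ _ MeasurableSet.of_discrete

/-- Independence is used twice: between clocks, and for each clock over the intervals `[M (q i), M
(q (i + 1)))`, which are disjoint because `M ∘ q` is monotone. -/
theorem Clocks.measure_biInter_onlyRing (hr : ∀ k a b, IntervalIntegrable (rate k) volume a b)
    (h0 : ∀ k t, 0 ≤ rate k t) {q : ℕ → ℝ} (hq : Monotone q) (κ : ℕ → Fin (n + 1))
    (s : Finset ℕ) :
    P (⋂ i ∈ s, c.onlyRing q κ i) = ∏ i ∈ s, ∏ k,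
      P (count (c.points k) (Ico (q i) (q (i + 1))) ⁻¹' allowedCount (κ i) k) := by
  have h1 : ⋂ i ∈ s, c.onlyRing q κ i = ⋂ k, ⋂ i ∈ s,
      count (c.points k) (Ico (q i) (q (i + 1))) ⁻¹' allowedCount (κ i) k := by
    ext ω
    simp only [c.onlyRing_eq_iInter, mem_iInter]
    exact ⟨fun h k i hi => h i hi k, fun h i hi k => h k i hi⟩
  rw [h1, c.indep.meas_iInter, Finset.prod_comm]
  · refine Finset.prod_congr rfl fun k _ => ?_
    simp only [funext (c.count_Ico hr h0 k _ _)]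
    exact (c.poisson k).measure_biInter
      (fun i => Ico (cumulative (rate k) (q i)) (cumulative (rate k) (q (i + 1))))
      (fun _ => measurableSet_Ico)
      ((cumulative_mono (hr k) (h0 k)).comp hq).pairwise_disjoint_on_Ico_succ
      (fun i => allowedCount (κ i) k) s
  · intro k
    refine Finset.measurableSet_biInter s fun i _ => ?_
    exact le_iSup (fun A : {A : Set ℝ // MeasurableSet A} =>
      MeasurableSpace.comap (count (c.points k) A.1) inferInstance) ⟨_, measurableSet_Ico⟩ _
        ⟨_, MeasurableSet.of_discrete, rfl⟩

theorem Clocks.iIndepSet_onlyRing (hr : ∀ k a b, IntervalIntegrable (rate k) volume a b)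
    (h0 : ∀ k t, 0 ≤ rate k t) {q : ℕ → ℝ} (hq : Monotone q) (κ : ℕ → Fin (n + 1)) :
    iIndepSet (c.onlyRing q κ) P := by
  rw [iIndepSet_iff_meas_biInter (c.measurableSet_onlyRing hr h0 q κ)]
  intro s
  rw [c.measure_biInter_onlyRing hr h0 hq]
  refine Finset.prod_congr rfl fun i _ => ?_
  simpa using (c.measure_biInter_onlyRing hr h0 hq κ {i}).symm

/-- A clock is silent with probability at least `exp (-b)` and rings with probability at least `1 -
exp (-a)`; each of the `n + 1` factors is thus at least `δ`. -/
theorem Clocks.le_measureReal_onlyRing [IsProbabilityMeasure P]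
    (hr : ∀ k a b, IntervalIntegrable (rate k) volume a b)
    (h0 : ∀ k t, 0 ≤ rate k t) {q : ℕ → ℝ} (hq : Monotone q) (κ : ℕ → Fin (n + 1))
    {a b : ℝ} (hab : ∀ i k, a ≤ ∫ s in (q i)..(q (i + 1)), rate k s ∧
      ∫ s in (q i)..(q (i + 1)), rate k s ≤ b) {δ : ℝ} (hδ : 0 ≤ δ) (hδa : δ ≤ 1 - Real.exp (-a))
    (hδb : δ ≤ Real.exp (-b)) (i : ℕ) :
    δ ^ (n + 1) ≤ P.real (c.onlyRing q κ i) := by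
  have h1 := c.measure_biInter_onlyRing hr h0 hq κ {i}
  simp only [Finset.mem_singleton, iInter_iInter_eq_left, Finset.prod_singleton] at h1
  rw [measureReal_def, h1, ENNReal.toReal_prod]
  calc δ ^ (n + 1) = ∏ _k : Fin (n + 1), δ := by simp
    _ ≤ _ := by
      refine Finset.prod_le_prod (fun _ _ => hδ) fun k _ => ?_
      have hz : P.real (count (c.points k) (Ico (q i) (q (i + 1))) ⁻¹' {0}) =
          Real.exp (-∫ s in (q i)..(q (i + 1)), rate k s) := by
        rw [funext (c.count_Ico hr h0 k _ _), (c.poisson k).real_count_eq_zero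
          (cumulative_mono (hr k) (h0 k) (hq (Nat.le_succ i))), cumulative_sub (hr k)]
      rw [← measureReal_def]
      unfold allowedCount
      split_ifs
      · rw [preimage_compl, probReal_compl_eq_one_sub
          (c.measurable_count_Ico hr h0 k _ _ MeasurableSet.of_discrete), hz]
        have := Real.exp_le_exp.2 (neg_le_neg (hab i k).1)
        linarith
      · rw [hz]
        exact hδb.trans (Real.exp_le_exp.2 (neg_le_neg (hab i k).2))

theorem Clocks.flow_eq_foldl {q : ℕ → ℝ} (hq : Monotone q) (κ : ℕ → Fin (n + 1)) {ω : Ω}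
    (i m : ℕ) (h : ∀ l < m, ω ∈ c.onlyRing q κ (i + l)) (x : Config n) :
    c.flow (q (i + m)) (q i) x ω = ((List.range m).map fun l => κ (i + l)).foldl hop x := by
  induction m with
  | zero => simpa using c.flow_self (q i) x ω
  | succ m ih =>
    have h1 : c.ringing (q (i + m + 1)) (q (i + m)) ω = {κ (i + m)} := h m m.lt_succ_self
    rw [c.flow_cocycle _ (q (i + m)) _ (hq (Nat.le_add_right _ _)) (hq (by omega)),
      ih fun l hl => h l (by omega), List.range_succ, List.map_append, List.foldl_append,
      List.map_singleton, List.foldl_cons, List.foldl_nil]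
    refine c.flow_eq_hop (κ (i + m)) ?_ (fun l hl => ?_) _
    · exact h1.symm.subset rfl
    · by_contra hl'
      exact hl (h1.subset (nonempty_iff_ne_empty.2 hl'))

/-- An earlier start only restricts the states reached at time `s`, and solutions that have merged
stay together. -/
theorem Clocks.syncEvent_mono {s t s' t' : ℝ} (h₁ : s' ≤ s) (h₂ : s ≤ t) (h₃ : t ≤ t') :
    syncEvent c.flow t s ⊆ syncEvent c.flow t' s' := by
  intro ω h x y
  rw [c.flow_cocycle t' t s' (h₁.trans h₂) h₃, c.flow_cocycle t s s' h₁ h₂,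
    c.flow_cocycle t' t s' (h₁.trans h₂) h₃ y, c.flow_cocycle t s s' h₁ h₂ y, h]

theorem Clocks.measurableSet_syncEvent (hr : ∀ k a b, IntervalIntegrable (rate k) volume a b)
    (h0 : ∀ k t, 0 ≤ rate k t) (t t₀ : ℝ) : MeasurableSet (syncEvent c.flow t t₀) := by
  have : syncEvent c.flow t t₀ =
      ⋂ x : Config n, ⋂ y : Config n, {ω | c.flow t t₀ x ω = c.flow t t₀ y ω} := by
    ext ω; simp [syncEvent]
  rw [this]
  exact MeasurableSet.iInter fun x => MeasurableSet.iInter fun y => measurableSet_eq_fun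
    (c.measurable_flow_apply hr h0 t t₀ x) (c.measurable_flow_apply hr h0 t t₀ y)

/-- If the division points `q` bound the rates jointly, the probability that the flow is not
synchronizing decays geometrically, uniformly in `q`. -/
theorem Clocks.exists_forall_one_sub_syncEvent_le [IsProbabilityMeasure P]
    (hr : ∀ k a b, IntervalIntegrable (rate k) volume a b)
    (h0 : ∀ k t, 0 ≤ rate k t) {a b : ℝ} (ha : 0 < a) :
    ∃ ρ : ℝ, 0 < ρ ∧ ρ < 1 ∧ ∀ q : ℕ → ℝ, Monotone q →
      (∀ i k, a ≤ ∫ s in (q i)..(q (i + 1)), rate k s ∧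
        ∫ s in (q i)..(q (i + 1)), rate k s ≤ b) →
      ∀ N : ℕ, 1 - P.real (syncEvent c.flow (q (N * (n * (n + 1) / 2))) (q 0)) ≤ ρ ^ N := by
  obtain ⟨κ₀, hκ₀⟩ := exists_synchronizing n
  set m := n * (n + 1) / 2
  have hexp : Real.exp (-a) < 1 := by
    rw [← Real.exp_zero]
    exact Real.exp_lt_exp.2 (by linarith)
  set δ := min (1 - Real.exp (-a)) (Real.exp (-b)) / 2 with hδ_def
  have hδ' : 0 < min (1 - Real.exp (-a)) (Real.exp (-b)) :=
    lt_min (by linarith) (Real.exp_pos _)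
  have hδ : 0 < δ := half_pos hδ'
  have hδa : δ ≤ 1 - Real.exp (-a) := (half_le_self hδ'.le).trans (min_le_left _ _)
  have hδb : δ ≤ Real.exp (-b) := (half_le_self hδ'.le).trans (min_le_right _ _)
  have hδ1 : δ < 1 := by linarith [Real.exp_pos (-a)]
  -- The exponent `m + 1` instead of `m` keeps this number below `1` even for `m = 0`.
  have hε : 0 < (δ ^ (n + 1)) ^ (m + 1) := by positivity
  have hε1 : (δ ^ (n + 1)) ^ (m + 1) < 1 :=
    pow_lt_one₀ (by positivity) (pow_lt_one₀ hδ.le hδ1 (Nat.succ_ne_zero _)) (Nat.succ_ne_zero _)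
  refine ⟨1 - (δ ^ (n + 1)) ^ (m + 1), by linarith, by linarith, fun q hq hab N => ?_⟩
  -- Periodic repetition makes every block of `m` intervals spell the whole word.
  let κ : ℕ → Fin (n + 1) := fun i => κ₀ (i % m)
  let G : ℕ → Set Ω := fun j => ⋂ l : Fin m, c.onlyRing q κ (j * m + l)
  have hGm : ∀ j, MeasurableSet (G j) := fun j =>
    MeasurableSet.iInter fun l => c.measurableSet_onlyRing hr h0 q κ _
  have hind := c.iIndepSet_onlyRing hr h0 hq κ
  have hGind : iIndepSet G P := iIndepSet.biInter_block (c.measurableSet_onlyRing hr h0 q κ) hind m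
  have hGε : ∀ j, (δ ^ (n + 1)) ^ (m + 1) ≤ P.real (G j) := by
    intro j
    have h1 : P (G j) = ∏ l : Fin m, P (c.onlyRing q κ (j * m + l)) := by
      have hinj : Function.Injective fun l : Fin m => j * m + l.val := fun l l' h =>
        Fin.ext (Nat.add_left_cancel h)
      simpa [G] using (hind.precomp hinj).meas_biInter Finset.univ
    rw [measureReal_def, h1, ENNReal.toReal_prod]
    calc (δ ^ (n + 1)) ^ (m + 1) ≤ (δ ^ (n + 1)) ^ m :=
          pow_le_pow_of_le_one (by positivity) (pow_le_one₀ hδ.le hδ1.le) (Nat.le_succ m)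
      _ = ∏ _l : Fin m, δ ^ (n + 1) := by simp
      _ ≤ _ := Finset.prod_le_prod (fun _ _ => by positivity) fun l _ =>
          c.le_measureReal_onlyRing hr h0 hq κ hab hδ.le hδa hδb _
  have hsub : (syncEvent c.flow (q (N * m)) (q 0))ᶜ ⊆ ⋂ j ∈ Finset.range N, (G j)ᶜ := by
    intro ω hω
    simp only [mem_iInter, Finset.mem_range]
    intro j hj hG
    refine hω (c.syncEvent_mono (s := q (j * m)) (t := q (j * m + m)) (hq (Nat.zero_le _))
      (hq (Nat.le_add_right _ _)) (hq ?_) fun x y => ?_)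
    · calc j * m + m = (j + 1) * m := by ring
        _ ≤ N * m := Nat.mul_le_mul_right _ hj
    · have hl : (List.range m).map (fun l => κ (j * m + l)) = (List.range m).map κ₀ := by
        refine List.map_congr_left fun l hl => ?_
        simp only [κ, Nat.mul_add_mod_self_right, Nat.mod_eq_of_lt (List.mem_range.1 hl)]
      have hmem : ∀ l < m, ω ∈ c.onlyRing q κ (j * m + l) := fun l hl =>
        mem_iInter.1 hG ⟨l, hl⟩
      rw [c.flow_eq_foldl hq κ _ m hmem, c.flow_eq_foldl hq κ _ m hmem, hl, hκ₀ x y]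
  rw [← probReal_compl_eq_one_sub (c.measurableSet_syncEvent hr h0 _ _)]
  exact (measureReal_mono hsub).trans (iIndepSet.measureReal_biInter_compl_le hGm hGind hGε N)

end Blocks

/-! ### Bounds for the rates over a period -/

section Rates

variable {n : ℕ} {T : ℝ} {rate : Fin (n + 1) → ℝ → ℝ}

theorem integral_period_pos (hT : 0 < T) {r : ℝ → ℝ} (h0 : ∀ t, 0 ≤ r t)
    (hi : IntegrableOn r (Icc 0 T)) (hne : ¬ r =ᵐ[volume.restrict (Icc 0 T)] 0) :
    0 < ∫ t in (0 : ℝ)..T, r t := by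
  rw [intervalIntegral.integral_of_le hT.le, ← integral_Icc_eq_integral_Ioc]
  refine (integral_nonneg h0).lt_of_ne fun h => hne ?_
  exact (integral_eq_zero_iff_of_nonneg h0 hi).1 h.symm

theorem intervalIntegrable_of_periodic (hT : 0 < T) {r : ℝ → ℝ} (hp : ∀ t, r (t + T) = r t)
    (hi : IntegrableOn r (Icc 0 T)) (a b : ℝ) : IntervalIntegrable r volume a b :=
  Function.Periodic.intervalIntegrable₀ hp hT.ne'
    ((intervalIntegrable_iff_integrableOn_Icc_of_le hT.le).2 hi) a b

theorem exists_integral_period_bounds (hT : 0 < T) (h0 : ∀ k t, 0 ≤ rate k t)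
    (hp : ∀ k t, rate k (t + T) = rate k t) (hi : ∀ k, IntegrableOn (rate k) (Icc 0 T))
    (hne : ∀ k, ¬ rate k =ᵐ[volume.restrict (Icc 0 T)] 0) :
    ∃ r R : ℝ, 0 < r ∧ r < R ∧ ∀ k t,
      r ≤ ∫ s in t..(t + T), rate k s ∧ ∫ s in t..(t + T), rate k s ≤ R := by
  obtain ⟨k₁, h₁⟩ := Finite.exists_min fun k => ∫ s in (0 : ℝ)..T, rate k s
  obtain ⟨k₂, h₂⟩ := Finite.exists_max fun k => ∫ s in (0 : ℝ)..T, rate k s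
  -- The summand `1` ensures `r < R` even if all the integrals coincide.
  refine ⟨∫ s in (0 : ℝ)..T, rate k₁ s, (∫ s in (0 : ℝ)..T, rate k₂ s) + 1,
    integral_period_pos hT (h0 k₁) (hi k₁) (hne k₁), by linarith [h₁ k₂], fun k t => ?_⟩
  have h : ∫ s in t..(t + T), rate k s = ∫ s in (0 : ℝ)..T, rate k s := by
    simpa using Function.Periodic.intervalIntegral_add_eq (hp k) t 0
  rw [h]
  exact ⟨h₁ k, by linarith [h₂ k]⟩

theorem jointlyBoundedRates_of_period (hT : 0 < T) {r R : ℝ}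
    (h : ∀ k t, r ≤ ∫ s in t..(t + T), rate k s ∧ ∫ s in t..(t + T), rate k s ≤ R)
    (m : ℕ) (τ : ℝ) : JointlyBoundedRates rate r R m τ (τ + m * T) := by
  refine ⟨fun i => τ + i.val * T, fun i j hij => ?_, by simp, by simp, fun i k => ?_⟩
  · have : (i.val : ℝ) < j.val := Nat.cast_lt.2 hij
    dsimp only
    gcongr
  · have e : τ + ((i.succ : Fin (m + 1)).val : ℝ) * T = τ + (i.castSucc.val : ℝ) * T + T := by
      simp only [Fin.val_succ, Fin.val_castSucc]; push_cast; ring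
    dsimp only
    rw [e]
    exact h k _

end Rates

/-! ### The limit set as pullback attractor -/

section LimitSet

variable {Ω : Type*} [MeasurableSpace Ω] {P : Measure Ω} {n : ℕ} {rate : Fin (n + 1) → ℝ → ℝ}
  (c : Clocks P n rate)

theorem Clocks.imageSet_imageSet {t s t₀ : ℝ} (h₁ : t₀ ≤ s) (h₂ : s ≤ t) (B : Set (Config n))
    (ω : Ω) : imageSet c.flow t s (imageSet c.flow s t₀ B ω) ω = imageSet c.flow t t₀ B ω := by
  unfold imageSet
  rw [image_image]
  simp only [← c.flow_cocycle t s t₀ h₁ h₂]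

theorem Clocks.imageSet_mono {t s t₀ : ℝ} (h₁ : t₀ ≤ s) (h₂ : s ≤ t) (ω : Ω) :
    imageSet c.flow t t₀ univ ω ⊆ imageSet c.flow t s univ ω := by
  rw [← c.imageSet_imageSet h₁ h₂]
  exact image_mono (subset_univ _)

theorem Clocks.fiber_limitSet (t : ℝ) (ω : Ω) :
    fiber (limitSet c.flow) t ω = ⋂ t₀ ≤ t, imageSet c.flow t t₀ univ ω := by
  ext x; simp [fiber, limitSet]

/-- The decreasing family of images is eventually constant, the state space being finite. -/
theorem Clocks.eventually_imageSet_eq (t : ℝ) (ω : Ω) :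
    ∀ᶠ t₀ in atBot, imageSet c.flow t t₀ univ ω = fiber (limitSet c.flow) t ω := by
  have h : ∀ x : Config n, ∀ᶠ t₀ in atBot,
      x ∈ imageSet c.flow t t₀ univ ω → x ∈ fiber (limitSet c.flow) t ω := by
    intro x
    by_cases hx : x ∈ fiber (limitSet c.flow) t ω
    · exact Eventually.of_forall fun _ _ => hx
    · simp only [fiber, limitSet, mem_ofPred_eq, not_forall] at hx
      obtain ⟨s, hs, hxs⟩ := hx
      filter_upwards [eventually_le_atBot s] with t₀ ht₀ hxt
      exact absurd (c.imageSet_mono ht₀ hs ω hxt) hxs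
  filter_upwards [eventually_all.2 h, eventually_le_atBot t] with t₀ h ht
  refine Subset.antisymm h ?_
  rw [c.fiber_limitSet]
  exact iInter₂_subset t₀ ht

theorem Clocks.fiber_limitSet_nonempty (t : ℝ) (ω : Ω) :
    (fiber (limitSet c.flow) t ω).Nonempty := by
  obtain ⟨t₀, h⟩ := (c.eventually_imageSet_eq t ω).exists
  rw [← h]
  exact univ_nonempty.image _

/-- For `s` early enough both sections are images of the whole space from time `s`, and the cocycle
property links them. -/
theorem Clocks.imageSet_fiber_limitSet {t t₀ : ℝ} (h : t₀ ≤ t) (ω : Ω) :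
    imageSet c.flow t t₀ (fiber (limitSet c.flow) t₀ ω) ω = fiber (limitSet c.flow) t ω := by
  obtain ⟨s, ⟨h₁, h₂⟩, h₃⟩ := ((c.eventually_imageSet_eq t₀ ω).and
    (c.eventually_imageSet_eq t ω)).and (eventually_le_atBot t₀) |>.exists
  rw [← h₁, ← h₂, c.imageSet_imageSet h₃ h]

/-- By monotonicity of the images, the uncountable intersection reduces to the starting times `t -
N`. -/
theorem Clocks.measurableSet_limitSet (hr : ∀ k a b, IntervalIntegrable (rate k) volume a b)
    (h0 : ∀ k t, 0 ≤ rate k t) (t : ℝ) : MeasurableSet (limitSet c.flow t) := by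
  have : limitSet c.flow t =
      ⋂ N : ℕ, ⋃ y : Config n, {p : Config n × Ω | p.1 = c.flow t (t - N) y p.2} := by
    ext p
    simp only [limitSet, mem_ofPred_eq, mem_iInter, mem_iUnion]
    constructor
    · intro h N
      obtain ⟨y, -, hy⟩ := h (t - N) (by simp)
      exact ⟨y, hy.symm⟩
    · intro h t₀ ht₀
      obtain ⟨N, hN⟩ := exists_nat_ge (t - t₀)
      obtain ⟨y, hy⟩ := h N
      exact c.imageSet_mono (t₀ := t - N) (by linarith) ht₀ p.2 ⟨y, mem_univ y, hy.symm⟩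
  rw [this]
  exact MeasurableSet.iInter fun N => MeasurableSet.iUnion fun y =>
    measurableSet_eq_fun measurable_fst ((c.measurable_flow_apply hr h0 _ _ y).comp measurable_snd)

theorem Clocks.isCompactRandomSet_limitSet
    (hr : ∀ k a b, IntervalIntegrable (rate k) volume a b) (h0 : ∀ k t, 0 ≤ rate k t) :
    IsCompactRandomSet (limitSet c.flow) where
  measurable := c.measurableSet_limitSet hr h0
  compact _ _ := (toFinite _).isCompact

theorem semiDist_self {X : Type*} [MetricSpace X] (A : Set X) : semiDist A A = 0 := by
  simp only [semiDist, ENNReal.iSup_eq_zero]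
  intro a ha
  exact le_antisymm ((iInf₂_le a ha).trans (edist_self a).le) zero_le

theorem Clocks.isGlobalPullbackAttractor (hr : ∀ k a b, IntervalIntegrable (rate k) volume a b)
    (h0 : ∀ k t, 0 ≤ rate k t) : IsGlobalPullbackAttractor P c.flow (limitSet c.flow) where
  randomSet := c.isCompactRandomSet_limitSet hr h0
  invariant := Eventually.of_forall fun ω _ _ h => c.imageSet_fiber_limitSet h ω
  attracts t := Eventually.of_forall fun ω => tendsto_nhds_of_eventually_eq <| by
    filter_upwards [c.eventually_imageSet_eq t ω] with t₀ h
    rw [h, semiDist_self]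

theorem Clocks.exists_imageSet_eq_singleton {t t₀ : ℝ} {ω : Ω} (h : ω ∈ syncEvent c.flow t t₀) :
    ∃ x, imageSet c.flow t t₀ univ ω = {x} := by
  obtain ⟨y⟩ : Nonempty (Config n) := inferInstance
  refine ⟨c.flow t t₀ y ω, Subset.antisymm ?_ (singleton_subset_iff.2 ⟨y, mem_univ y, rfl⟩)⟩
  rintro _ ⟨z, -, rfl⟩
  exact h z y

/-- The section is a nonempty subset of the image, which is a singleton. -/
theorem Clocks.fiber_limitSet_eq_imageSet {t t₀ : ℝ} (ht : t₀ ≤ t) {ω : Ω}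
    (h : ω ∈ syncEvent c.flow t t₀) :
    fiber (limitSet c.flow) t ω = imageSet c.flow t t₀ univ ω := by
  obtain ⟨x, hx⟩ := c.exists_imageSet_eq_singleton h
  have hsub : fiber (limitSet c.flow) t ω ⊆ imageSet c.flow t t₀ univ ω := by
    rw [c.fiber_limitSet]
    exact iInter₂_subset t₀ ht
  rw [hx] at hsub ⊢
  exact (subset_singleton_iff_eq.1 hsub).resolve_left (c.fiber_limitSet_nonempty t ω).ne_empty

end LimitSet

/-! ### Singleton sections, forward attraction and the exponential rate -/

section Attraction

variable {Ω : Type*} [MeasurableSpace Ω] {P : Measure Ω} {n : ℕ} {rate : Fin (n + 1) → ℝ → ℝ}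
  (c : Clocks P n rate)

theorem ae_exists_mem_of_tendsto [IsProbabilityMeasure P] {G : ℕ → Set Ω}
    (hG : ∀ N, MeasurableSet (G N)) (h : Tendsto (fun N => 1 - P.real (G N)) atTop (𝓝 0)) :
    ∀ᵐ ω ∂P, ∃ N, ω ∈ G N := by
  have hz : P.real (⋂ N, (G N)ᶜ) ≤ 0 := ge_of_tendsto' h fun N => by
    rw [← probReal_compl_eq_one_sub (hG N)]
    exact measureReal_mono (iInter_subset _ N)
  have hz' : P (⋂ N, (G N)ᶜ) = 0 :=
    (measureReal_eq_zero_iff).1 (le_antisymm hz measureReal_nonneg)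
  rw [ae_iff]
  convert hz' using 2
  ext ω
  simp

variable {C γ : ℝ}

theorem tendsto_one_sub_of_exp_bound [IsProbabilityMeasure P] (hγ : 0 < γ) {G : ℕ → Set Ω}
    (h : ∀ N : ℕ, 1 - P.real (G N) ≤ C * Real.exp (-γ * N)) :
    Tendsto (fun N => 1 - P.real (G N)) atTop (𝓝 0) := by
  refine squeeze_zero (fun N => sub_nonneg.2 measureReal_le_one) h ?_
  have h1 : Tendsto (fun N : ℕ => -γ * (N : ℝ)) atTop atBot :=
    tendsto_natCast_atTop_atTop.const_mul_atTop_of_neg (by linarith)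
  simpa using (Real.tendsto_exp_atBot.comp h1).const_mul C

/-- Only countably many null sets arise: synchronization by the integer time `⌊t⌋` persists to `t`.
-/
theorem Clocks.ae_fiber_limitSet_eq_singleton [IsProbabilityMeasure P]
    (hr : ∀ k a b, IntervalIntegrable (rate k) volume a b) (h0 : ∀ k t, 0 ≤ rate k t)
    (hγ : 0 < γ) (h : ∀ t t₀ : ℝ, t₀ ≤ t →
      1 - P.real (syncEvent c.flow t t₀) ≤ C * Real.exp (-γ * (t - t₀))) :
    ∀ᵐ ω ∂P, ∀ t, ∃ x, fiber (limitSet c.flow) t ω = {x} := by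
  have h1 : ∀ z : ℤ, ∀ᵐ ω ∂P, ∃ N : ℕ, ω ∈ syncEvent c.flow z (z - N) := fun z =>
    ae_exists_mem_of_tendsto (fun N => c.measurableSet_syncEvent hr h0 _ _)
      (tendsto_one_sub_of_exp_bound hγ fun N => by
        simpa using h z (z - N) (by simp))
  filter_upwards [ae_all_iff.2 h1] with ω hω t
  obtain ⟨N, hN⟩ := hω ⌊t⌋
  have hN' := c.syncEvent_mono (le_refl _) (by simp) (Int.floor_le t) hN
  rw [c.fiber_limitSet_eq_imageSet ((by simp : (⌊t⌋ : ℝ) - N ≤ ⌊t⌋).trans (Int.floor_le t)) hN']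
  exact c.exists_imageSet_eq_singleton hN'

/-- The bound depends only on `t - t₀`, so it also forces almost sure synchronization forward in
time; from then on the distance is exactly zero. -/
theorem Clocks.isGlobalForwardAttractor [IsProbabilityMeasure P]
    (hr : ∀ k a b, IntervalIntegrable (rate k) volume a b) (h0 : ∀ k t, 0 ≤ rate k t)
    (hγ : 0 < γ) (h : ∀ t t₀ : ℝ, t₀ ≤ t →
      1 - P.real (syncEvent c.flow t t₀) ≤ C * Real.exp (-γ * (t - t₀))) :
    IsGlobalForwardAttractor P c.flow (limitSet c.flow) where
  randomSet := c.isCompactRandomSet_limitSet hr h0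
  invariant := Eventually.of_forall fun ω _ _ h => c.imageSet_fiber_limitSet h ω
  attracts t₀ := by
    have h1 : ∀ᵐ ω ∂P, ∃ N : ℕ, ω ∈ syncEvent c.flow (t₀ + N) t₀ :=
      ae_exists_mem_of_tendsto (fun N => c.measurableSet_syncEvent hr h0 _ _)
        (tendsto_one_sub_of_exp_bound hγ fun N => by
          simpa using h (t₀ + N) t₀ (by simp))
    filter_upwards [h1] with ω ⟨N, hN⟩
    refine tendsto_nhds_of_eventually_eq ?_
    filter_upwards [eventually_ge_atTop (t₀ + N)] with t ht
    rw [c.fiber_limitSet_eq_imageSet ((by simp : t₀ ≤ t₀ + N).trans ht)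
      (c.syncEvent_mono le_rfl (by simp) ht hN), semiDist_self]

theorem Clocks.exists_exp_bound [IsProbabilityMeasure P]
    (hr : ∀ k a b, IntervalIntegrable (rate k) volume a b) (h0 : ∀ k t, 0 ≤ rate k t)
    (hn : 1 ≤ n) {T : ℝ} (hT : 0 < T) {r R : ℝ} (hr0 : 0 < r)
    (h : ∀ k t, r ≤ ∫ s in t..(t + T), rate k s ∧ ∫ s in t..(t + T), rate k s ≤ R) :
    ∃ C γ : ℝ, 0 < C ∧ 0 < γ ∧ ∀ t t₀ : ℝ, t₀ ≤ t →
      1 - P.real (syncEvent c.flow t t₀) ≤ C * Real.exp (-γ * (t - t₀)) := by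
  obtain ⟨ρ, hρ0, hρ1, hρ⟩ := c.exists_forall_one_sub_syncEvent_le (P := P) hr h0 (b := R) hr0
  set m := n * (n + 1) / 2
  have hm : 0 < m := Nat.div_pos (by nlinarith) two_pos
  have hΔ : 0 < (m : ℝ) * T := mul_pos (Nat.cast_pos.2 hm) hT
  have hlog : Real.log ρ < 0 := Real.log_neg hρ0 hρ1
  -- With `u = (t - t₀) / (m * T)`, the interval contains `⌊u⌋₊` whole blocks, and `ρ ^ ⌊u⌋₊ ≤ ρ ^
  -- (u - 1)`; the factor `ρ⁻¹` pays for the incomplete block.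
  refine ⟨ρ⁻¹, -Real.log ρ / (m * T), inv_pos.2 hρ0, div_pos (by linarith) hΔ,
    fun t t₀ ht => ?_⟩
  set u := (t - t₀) / (m * T)
  have hu : 0 ≤ u := div_nonneg (by linarith) hΔ.le
  set N := ⌊u⌋₊
  have hq : Monotone fun i : ℕ => t₀ + i * T := fun i j hij => by
    have : (i : ℝ) ≤ j := Nat.cast_le.2 hij
    dsimp only
    gcongr
  have h1 := hρ _ hq (fun i k => by
    have e : t₀ + ((i + 1 : ℕ) : ℝ) * T = t₀ + i * T + T := by push_cast; ring
    rw [e]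
    exact h k _) N
  have h2 : t₀ + ((N * m : ℕ) : ℝ) * T ≤ t := by
    have := (le_div_iff₀ hΔ).1 (Nat.floor_le hu)
    push_cast
    linarith
  have h3 : P.real (syncEvent c.flow (t₀ + ((N * m : ℕ) : ℝ) * T) (t₀ + ((0 : ℕ) : ℝ) * T)) ≤
      P.real (syncEvent c.flow t t₀) :=
    measureReal_mono (c.syncEvent_mono (by simp) (hq (Nat.zero_le _)) h2)
  have h4 : ρ ^ N ≤ ρ⁻¹ * Real.exp (-(-Real.log ρ / (m * T)) * (t - t₀)) := by
    have e : ρ⁻¹ * Real.exp (-(-Real.log ρ / (m * T)) * (t - t₀)) = ρ ^ (u - 1) := by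
      rw [Real.rpow_sub_one hρ0.ne', Real.rpow_def_of_pos hρ0, mul_comm, ← div_eq_mul_inv]
      congr 2
      simp only [u]
      ring
    rw [e, ← Real.rpow_natCast]
    exact Real.rpow_le_rpow_of_exponent_ge hρ0 hρ1.le (by linarith [Nat.lt_floor_add_one u])
  linarith

end Attraction

end TASEP

end

theorem mainTheorem4 {Ω : Type*} [MeasurableSpace Ω] (P : Measure Ω) [IsProbabilityMeasure P]
    (n : ℕ) (hn : 1 ≤ n) (T : ℝ) (hT : 0 < T) (rate : Fin (n + 1) → ℝ → ℝ)
    (rate_nonneg : ∀ k t, 0 ≤ rate k t)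
    (rate_periodic : ∀ k t, rate k (t + T) = rate k t)
    (rate_integrable : ∀ k, IntegrableOn (rate k) (Icc 0 T))
    (rate_ne_zero : ∀ k, ¬ rate k =ᵐ[volume.restrict (Icc 0 T)] 0)
    (c : TASEP.Clocks P n rate) :
    -- the rate condition holds on all intervals of length `n(n+1)T/2`
    (∃ r R : ℝ, 0 < r ∧ r < R ∧ ∀ τ : ℝ, TASEP.JointlyBoundedRates rate r R (n * (n + 1) / 2)
      τ (τ + (n : ℝ) * (n + 1) / 2 * T)) ∧
    TASEP.IsNRDS c.flow ∧
    -- (a)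
    TASEP.IsGlobalPullbackAttractor P c.flow (TASEP.limitSet c.flow) ∧
    (∀ᵐ ω ∂P, ∀ t, ∃ x, TASEP.fiber (TASEP.limitSet c.flow) t ω = {x}) ∧
    -- (b)
    TASEP.IsGlobalForwardAttractor P c.flow (TASEP.limitSet c.flow) ∧
    (∃ C γ : ℝ, 0 < C ∧ 0 < γ ∧ ∀ t t₀ : ℝ, t₀ ≤ t →
      1 - P.real (TASEP.syncEvent c.flow t t₀) ≤ C * Real.exp (-γ * (t - t₀))) := by
  have hr : ∀ k a b, IntervalIntegrable (rate k) volume a b := fun k =>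
    TASEP.intervalIntegrable_of_periodic hT (rate_periodic k) (rate_integrable k)
  obtain ⟨r, R, hr0, hrR, hbd⟩ := TASEP.exists_integral_period_bounds hT rate_nonneg rate_periodic
    rate_integrable rate_ne_zero
  obtain ⟨C, γ, hC, hγ, hexp⟩ := c.exists_exp_bound hr rate_nonneg hn hT hr0 hbd
  refine ⟨⟨r, R, hr0, hrR, fun τ => ?_⟩, c.isNRDS_flow hr rate_nonneg,
    c.isGlobalPullbackAttractor hr rate_nonneg,
    c.ae_fiber_limitSet_eq_singleton hr rate_nonneg hγ hexp,
    c.isGlobalForwardAttractor hr rate_nonneg hγ hexp, C, γ, hC, hγ, hexp⟩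
  -- The natural-number division is exact because `n (n + 1)` is even.
  have hm : ((n * (n + 1) / 2 : ℕ) : ℝ) = (n : ℝ) * (n + 1) / 2 := by
    rw [Nat.cast_div (even_iff_two_dvd.1 (Nat.even_mul_succ_self n)) two_ne_zero]
    push_cast
    ring
  rw [← hm]
  exact TASEP.jointlyBoundedRates_of_period hT hbd _ τ
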